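/- **Theorem 5 (Generalized Bianchi identities).** Let $M$ be a paracompact (Hausdorff) finite-dimensional $C^\infty$ manifold and $\mathfrak X(M)$ its module of smooth vector fields. A vector $l$-form on $M$ is an alternating $C^\infty(M)$-multilinear map $\mathfrak X(M)^l\to\mathfrak X(M)$, and $[\cdot,\cdot]$ denotes the Frölicher–Nijenhuis bracket of vector forms. Let $L$ be a vector $1$-form of constant rank $n\ge 1$ with $\tfrac12[L,L]=0$ and $\operatorname{Im}(L_z)=\operatorname{Ker}(L_z)$ for all $z\in M$. Let $\Gamma$ be an $L$-connection, i.e. a vector $1$-form with $L\Gamma=L$ and $\Gamma L=-L$. Let $h=\tfrac12(I+\Gamma)$ be its horizontal projector, $T=\tfrac12[L,\Gamma]$ its torsion and $R=-\tfrac12[h,h]$ its curvature. Then (a) $[L,R]=[h,T]$; (b) $[h,R]=0$. Suppose moreover that $C$ is a canonical vector field of $L$: a smooth vector field such that around every point of $M$ there are coordinates $(x^1,\dots,x^n;y^1,\dots,y^n)$ with $L\frac{\partial}{\partial x^i}=\frac{\partial}{\partial y^i}$, $L\frac{\partial}{\partial y^i}=0$ and $C=\sum_i y^i\frac{\partial}{\partial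 y^i}$. Call a smooth vector field $S'$ with $LS'=C$ an $L$-semispray. Let $S=hS'$ be the canonical $L$-semispray of $\Gamma$, where $S'$ is an arbitrary $L$-semispray, and let $t=T^\circ-\tfrac12[C,\Gamma]$ be the strong torsion of $\Gamma$, where $T^\circ=i_{S'}T=T(S',\cdot)$ for an arbitrary $L$-semispray $S'$ ($S$ and $t$ do not depend on the choice of $S'$). Then identity (b) can be put in the form $$[[L,S],R]=-[t,R].$$ -/

import Mathlib

open scoped Manifold ContDiff

noncomputable section

namespace LConn

/-! ### Functions, vector fields and vector forms on a smooth manifold `M` modelled on `E` -/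

/-- The algebra `𝔉(M)` of smooth real functions. -/
abbrev Fun (E M : Type*) [NormedAddCommGroup E] [NormedSpace ℝ E]
    [TopologicalSpace M] [ChartedSpace E M] :=
  C^∞⟮𝓘(ℝ, E), M; ℝ⟯

/-- The smooth vector fields `𝔛(M)`: smooth sections of the tangent bundle. -/
abbrev VField (E M : Type*) [NormedAddCommGroup E] [NormedSpace ℝ E]
    [TopologicalSpace M] [ChartedSpace E M] [IsManifold 𝓘(ℝ, E) ∞ M] :=
  Cₛ^∞⟮𝓘(ℝ, E); E, (TangentSpace 𝓘(ℝ, E) : M → Type _)⟯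

section Basic

variable {E M : Type*} [NormedAddCommGroup E] [NormedSpace ℝ E]
  [TopologicalSpace M] [ChartedSpace E M] [IsManifold 𝓘(ℝ, E) ∞ M]

/-- Multiplication of a vector field by a smooth function. -/
instance : SMul (Fun E M) (VField E M) where
  smul f X := ⟨fun z => f z • X z, f.contMDiff.smul_section X.contMDiff⟩

theorem smul_apply (f : Fun E M) (X : VField E M) (z : M) : (f • X) z = f z • X z := rfl

instance : Module (Fun E M) (VField E M) where
  one_smul X := by ext z; simp [smul_apply]
  mul_smul f g X := by
    ext z
    exact mul_smul (f z) (g z) (X z)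
  smul_zero f := by ext z; simp [smul_apply]
  smul_add f X Y := by
    ext z
    exact smul_add (f z) (X z) (Y z)
  add_smul f g X := by
    ext z
    exact add_smul (f z) (g z) (X z)
  zero_smul X := by ext z; simp [smul_apply]

instance : IsScalarTower ℝ (Fun E M) (VField E M) where
  smul_assoc c f X := by
    ext z
    exact smul_assoc c (f z) (X z)

instance : SMulCommClass (Fun E M) ℝ (VField E M) where
  smul_comm f c X := by
    ext z
    exact smul_comm (f z) c (X z)

instance : SMulCommClass ℝ (Fun E M) (VField E M) where
  smul_comm c f X := by
    ext z
    exact smul_comm c (f z) (X z)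

/-- Evaluation `X ↦ X_z` of vector fields at a point. -/
def evalAt (z : M) : VField E M →ₗ[ℝ] TangentSpace 𝓘(ℝ, E) z where
  toFun X := X z
  map_add' _ _ := rfl
  map_smul' _ _ := rfl

variable (E M) in
/-- The `𝔉(M)`-module `Ψ¹(M)` of vector 1-forms, i.e. `𝔉(M)`-linear maps `𝔛(M) → 𝔛(M)`. -/
abbrev VForm1 := VField E M →ₗ[Fun E M] VField E M

variable (E M) in
/-- The `𝔉(M)`-module `Ψˡ(M)` of vector `l`-forms, i.e. alternating `𝔉(M)`-multilinear maps
`𝔛(M) × ⋯ × 𝔛(M) → 𝔛(M)`. -/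
abbrev VForm (l : ℕ) := VField E M [⋀^Fin l]→ₗ[Fun E M] VField E M

/-- The image `L_z(T_zM)` of a vector 1-form at `z`: the vectors `(LX)_z`, `X ∈ 𝔛(M)`. -/
def imageAt (L : VForm1 E M) (z : M) : Submodule ℝ (TangentSpace 𝓘(ℝ, E) z) :=
  LinearMap.range (evalAt z ∘ₗ L.restrictScalars ℝ)

/-- The kernel of `L_z : T_zM → T_zM`: the vectors `X_z`, where `X ∈ 𝔛(M)` has `(LX)_z = 0`. -/
def kerAt (L : VForm1 E M) (z : M) : Submodule ℝ (TangentSpace 𝓘(ℝ, E) z) :=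
  (LinearMap.ker (evalAt z ∘ₗ L.restrictScalars ℝ)).map (evalAt z)

theorem fin_two (i : Fin 2) : i = 0 ∨ i = 1 := by omega

theorem fin_three (i : Fin 3) : i = 0 ∨ i = 1 ∨ i = 2 := by omega

theorem fin_three_ne : (0 : Fin 3) ≠ 1 ∧ (0 : Fin 3) ≠ 2 ∧ (1 : Fin 3) ≠ 0 ∧ (1 : Fin 3) ≠ 2 ∧
    (2 : Fin 3) ≠ 0 ∧ (2 : Fin 3) ≠ 1 := by decide

theorem eq_zero_of_eq_neg {X : VField E M} (h : X = -X) : X = 0 := by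
  ext z
  have hz : X z = -X z := congrArg (fun Y : VField E M => Y z) h
  have h2 : (2 : ℝ) • X z = 0 := by
    rw [two_smul]
    nth_rewrite 1 [hz]
    exact neg_add_cancel _
  exact (smul_eq_zero.1 h2).resolve_left two_ne_zero

/-- Build a vector 2-form. -/
def VForm.mk₂ (f : VField E M → VField E M → VField E M)
    (add : ∀ X X' Y, f (X + X') Y = f X Y + f X' Y)
    (smul : ∀ (a : Fun E M) X Y, f (a • X) Y = a • f X Y)
    (anti : ∀ X Y, f X Y = -f Y X) : VForm E M 2 where
  toFun m := f (m 0) (m 1)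
  map_update_add' m i x y := by
    have add' : ∀ X Y Y', f X (Y + Y') = f X Y + f X Y' := fun X Y Y' => by
      rw [anti, add, anti X Y, anti X Y', neg_add]
    rcases fin_two i with rfl | rfl <;> simp [add, add']
  map_update_smul' m i a x := by
    have smul' : ∀ (a : Fun E M) X Y, f X (a • Y) = a • f X Y := fun a X Y => by
      rw [anti, smul, anti X Y, smul_neg]
    rcases fin_two i with rfl | rfl <;> simp [smul, smul']
  map_eq_zero_of_eq' m i j hm hij := by
    have alt : ∀ X, f X X = 0 := fun X => eq_zero_of_eq_neg (anti X X)
    change f (m 0) (m 1) = 0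
    rcases fin_two i with rfl | rfl <;> rcases fin_two j with rfl | rfl <;>
      first
      | exact (hij rfl).elim
      | (rw [hm]; exact alt _)

/-- Build a vector 3-form. -/
def VForm.mk₃ (f : VField E M → VField E M → VField E M → VField E M)
    (add : ∀ X X' Y Z, f (X + X') Y Z = f X Y Z + f X' Y Z)
    (smul : ∀ (a : Fun E M) X Y Z, f (a • X) Y Z = a • f X Y Z)
    (cyc : ∀ X Y Z, f X Y Z = f Y Z X)
    (anti : ∀ X Y Z, f X Y Z = -f X Z Y) : VForm E M 3 where
  toFun m := f (m 0) (m 1) (m 2)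
  map_update_add' m i x y := by
    have add₁ : ∀ X Y Y' Z, f X (Y + Y') Z = f X Y Z + f X Y' Z := fun X Y Y' Z => by
      rw [cyc, add, ← cyc X Y Z, ← cyc X Y' Z]
    have add₂ : ∀ X Y Z Z', f X Y (Z + Z') = f X Y Z + f X Y Z' := fun X Y Z Z' => by
      rw [cyc, add₁, ← cyc X Y Z, ← cyc X Y Z']
    obtain ⟨h01, h02, h10, h12, h20, h21⟩ := fin_three_ne
    rcases fin_three i with rfl | rfl | rfl <;>
      simp only [Function.update_self, Function.update_of_ne h01, Function.update_of_ne h02,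
        Function.update_of_ne h10, Function.update_of_ne h12, Function.update_of_ne h20,
        Function.update_of_ne h21, add, add₁, add₂]
  map_update_smul' m i a x := by
    have smul₁ : ∀ (a : Fun E M) X Y Z, f X (a • Y) Z = a • f X Y Z := fun a X Y Z => by
      rw [cyc, smul, ← cyc]
    have smul₂ : ∀ (a : Fun E M) X Y Z, f X Y (a • Z) = a • f X Y Z := fun a X Y Z => by
      rw [cyc, smul₁, ← cyc]
    obtain ⟨h01, h02, h10, h12, h20, h21⟩ := fin_three_ne
    rcases fin_three i with rfl | rfl | rfl <;>
      simp only [Function.update_self, Function.update_of_ne h01, Function.update_of_ne h02,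
        Function.update_of_ne h10, Function.update_of_ne h12, Function.update_of_ne h20,
        Function.update_of_ne h21, smul, smul₁, smul₂]
  map_eq_zero_of_eq' m i j hm hij := by
    have alt : ∀ X Y, f X Y Y = 0 := fun X Y => eq_zero_of_eq_neg (anti X Y Y)
    have alt₁ : ∀ X Y, f Y Y X = 0 := fun X Y => by rw [← cyc, alt]
    have alt₂ : ∀ X Y, f Y X Y = 0 := fun X Y => by rw [cyc, alt]
    change f (m 0) (m 1) (m 2) = 0
    rcases fin_three i with rfl | rfl | rfl <;> rcases fin_three j with rfl | rfl | rfl <;>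
      first
      | exact (hij rfl).elim
      | (rw [hm]; first | exact alt _ _ | exact alt₁ _ _ | exact alt₂ _ _)

@[simp] theorem VForm.mk₂_apply {f : VField E M → VField E M → VField E M} {add smul anti}
    (X Y : VField E M) : VForm.mk₂ f add smul anti ![X, Y] = f X Y := rfl

@[simp] theorem VForm.mk₃_apply {f : VField E M → VField E M → VField E M → VField E M}
    {add smul cyc anti} (X Y Z : VField E M) :
    VForm.mk₃ f add smul cyc anti ![X, Y, Z] = f X Y Z := rfl

theorem VForm.swap (A : VForm E M 2) (X Y : VField E M) : A ![X, Y] = -A ![Y, X] := by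
  have h := A.map_swap ![Y, X] (i := 0) (j := 1) (by decide)
  rw [← h]
  congr 1
  ext i
  fin_cases i <;> rfl

theorem VForm.add_left (A : VForm E M 2) (X X' Y : VField E M) :
    A ![X + X', Y] = A ![X, Y] + A ![X', Y] := A.map_vecCons_add ![Y] X X'

theorem VForm.smul_left (A : VForm E M 2) (a : Fun E M) (X Y : VField E M) :
    A ![a • X, Y] = a • A ![X, Y] := A.map_vecCons_smul ![Y] a X

theorem VForm.add_right (A : VForm E M 2) (X Y Y' : VField E M) :
    A ![X, Y + Y'] = A ![X, Y] + A ![X, Y'] := by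
  rw [A.swap, A.add_left, A.swap X Y, A.swap X Y', neg_add]

theorem VForm.smul_right (A : VForm E M 2) (a : Fun E M) (X Y : VField E M) :
    A ![X, a • Y] = a • A ![X, Y] := by
  rw [A.swap, A.smul_left, A.swap X Y, smul_neg]

/-- The interior product `i_S A = A(S, ·)` of a vector 2-form. -/
def iprod₂ (S : VField E M) (A : VForm E M 2) : VForm1 E M where
  toFun Y := A ![S, Y]
  map_add' := A.add_right S
  map_smul' a Y := A.smul_right a S Y

/-- The derivative `X·f` of a function along a vector field. -/
def dirDeriv (X : VField E M) (f : Fun E M) : Fun E M where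
  val z := mvfderiv 𝓘(ℝ, E) f z (X z)
  property := by
    have h := (f.contMDiff.contMDiff_tangentMap (m := ∞) (by simp)).comp X.contMDiff
    exact contMDiff_snd_tangentBundle_modelSpace ℝ 𝓘(ℝ, ℝ) |>.comp h

theorem dirDeriv_apply (X : VField E M) (f : Fun E M) (z : M) :
    dirDeriv X f z = mvfderiv 𝓘(ℝ, E) f z (X z) := rfl

end Basic

/-! ### The Lie bracket and the Frölicher–Nijenhuis bracket -/

section Bracket

variable {E M : Type*} [NormedAddCommGroup E] [NormedSpace ℝ E] [FiniteDimensional ℝ E]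
  [TopologicalSpace M] [ChartedSpace E M] [IsManifold 𝓘(ℝ, E) ∞ M]

/-- The Lie bracket `[X, Y]` of smooth vector fields. -/
instance : Bracket (VField E M) (VField E M) where
  bracket X Y := ⟨VectorField.mlieBracket 𝓘(ℝ, E) X Y, by
    have : CompleteSpace E := FiniteDimensional.complete ℝ E
    have : IsManifold 𝓘(ℝ, E) (minSmoothness ℝ 2) M := by
      rw [minSmoothness_of_isRCLikeNormedField]
      infer_instance
    have : IsManifold 𝓘(ℝ, E) ((⊤ : ℕ∞) + 1 : WithTop ℕ∞) M := by simpa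
    intro z
    exact ContMDiffAt.mlieBracket_vectorField (m := ⊤) (n := ⊤) (X.contMDiff z) (Y.contMDiff z)
      (by simp)⟩

theorem bracket_apply (X Y : VField E M) (z : M) :
    ⁅X, Y⁆ z = VectorField.mlieBracket 𝓘(ℝ, E) X Y z := rfl

theorem bracket_swap (X Y : VField E M) : ⁅X, Y⁆ = -⁅Y, X⁆ := by
  ext z
  exact VectorField.mlieBracket_swap_apply

theorem bracket_add_left (X X' Y : VField E M) : ⁅X + X', Y⁆ = ⁅X, Y⁆ + ⁅X', Y⁆ := by
  have : CompleteSpace E := FiniteDimensional.complete ℝ E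
  have : IsManifold 𝓘(ℝ, E) (minSmoothness ℝ 2) M := by
    rw [minSmoothness_of_isRCLikeNormedField]
    infer_instance
  ext z
  exact VectorField.mlieBracket_add_left X.mdifferentiableAt X'.mdifferentiableAt

theorem bracket_add_right (X Y Y' : VField E M) : ⁅X, Y + Y'⁆ = ⁅X, Y⁆ + ⁅X, Y'⁆ := by
  rw [bracket_swap, bracket_add_left, bracket_swap X Y, bracket_swap X Y', neg_add]

theorem bracket_smul_right (f : Fun E M) (X Y : VField E M) :
    ⁅X, f • Y⁆ = dirDeriv X f • Y + f • ⁅X, Y⁆ := by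
  have : CompleteSpace E := FiniteDimensional.complete ℝ E
  have : IsManifold 𝓘(ℝ, E) (minSmoothness ℝ 2) M := by
    rw [minSmoothness_of_isRCLikeNormedField]
    infer_instance
  ext z
  exact VectorField.mlieBracket_smul_right f.mdifferentiableAt Y.mdifferentiableAt

theorem bracket_smul_left (f : Fun E M) (X Y : VField E M) :
    ⁅f • X, Y⁆ = f • ⁅X, Y⁆ - dirDeriv Y f • X := by
  rw [bracket_swap, bracket_smul_right, bracket_swap X Y, smul_neg]
  abel

/-- The Frölicher–Nijenhuis bracket `[X, K]` of a vector field and a vector 1-form: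
`[X, K](Y) = [X, KY] - K[X, Y]`. -/
def fn01 (X : VField E M) (K : VForm1 E M) : VForm1 E M where
  toFun Y := ⁅X, K Y⁆ - K ⁅X, Y⁆
  map_add' Y Y' := by
    simp only [map_add, bracket_add_right]
    abel
  map_smul' f Y := by
    simp only [map_add, map_smul, bracket_smul_right, RingHom.id_apply, smul_sub]
    abel

/-- The Frölicher–Nijenhuis bracket `[K, X] = -[X, K]` of a vector 1-form and a vector field, so
`[K, X](Y) = [KY, X] - K[Y, X]`. -/
def fn10 (K : VForm1 E M) (X : VField E M) : VForm1 E M := -fn01 X K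

/-- The Frölicher–Nijenhuis bracket `[K, L]` of two vector 1-forms. -/
def fn11 (K L : VForm1 E M) : VForm E M 2 :=
  VForm.mk₂
    (fun X Y => ⁅K X, L Y⁆ + ⁅L X, K Y⁆ + K (L ⁅X, Y⁆) + L (K ⁅X, Y⁆)
      - K ⁅L X, Y⁆ - K ⁅X, L Y⁆ - L ⁅K X, Y⁆ - L ⁅X, K Y⁆)
    (fun X X' Y => by
      simp only [map_add, bracket_add_left]
      abel)
    (fun f X Y => by
      simp only [map_sub, map_smul, bracket_smul_left, smul_sub, smul_add]
      abel)
    (fun X Y => by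
      rw [bracket_swap (K X) (L Y), bracket_swap (L X) (K Y), bracket_swap X Y,
        bracket_swap (L X) Y, bracket_swap X (L Y), bracket_swap (K X) Y, bracket_swap X (K Y)]
      simp only [map_neg]
      abel)

/-- One of the three cyclic summands of `fn12`. -/
def fn12Aux (K : VForm1 E M) (A : VForm E M 2) (X Y Z : VField E M) : VField E M :=
  ⁅K X, A ![Y, Z]⁆ - A ![⁅K X, Y⁆, Z] - A ![Y, ⁅K X, Z⁆]
    - K ⁅X, A ![Y, Z]⁆ + K (A ![⁅X, Y⁆, Z]) + A ![K ⁅X, Y⁆, Z]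

/-- The Frölicher–Nijenhuis bracket `[K, A]` of a vector 1-form `K` and a vector 2-form `A`:
`[K, A](X, Y, Z)` is the cyclic sum over `X, Y, Z` of
`[KX, A(Y,Z)] - A([KX,Y], Z) - A(Y, [KX,Z]) - K[X, A(Y,Z)] + K A([X,Y], Z) + A(K[X,Y], Z)`. -/
def fn12 (K : VForm1 E M) (A : VForm E M 2) : VForm E M 3 :=
  VForm.mk₃ (fun X Y Z => fn12Aux K A X Y Z + fn12Aux K A Y Z X + fn12Aux K A Z X Y)
    (fun X X' Y Z => by
      simp only [fn12Aux, map_add, bracket_add_left, bracket_add_right, A.add_left, A.add_right]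
      abel)
    (fun f X Y Z => by
      have neg_left : ∀ U V, A ![-U, V] = -A ![U, V] := fun U V => by
        have := A.smul_left (-1) U V
        simpa using this
      have neg_right : ∀ U V, A ![U, -V] = -A ![U, V] := fun U V => by
        rw [A.swap, neg_left, A.swap U V]
      simp only [fn12Aux, map_add, map_smul, bracket_smul_left, bracket_smul_right,
        A.add_left, A.add_right, A.smul_left, A.smul_right, smul_add,
        sub_eq_add_neg, neg_left, neg_right, neg_add, map_neg, smul_neg]
      rw [A.swap Z X, A.swap (K X) Y]
      simp only [smul_neg, map_neg]
      abel)
    (fun X Y Z => by abel)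
    (fun X Y Z => by
      have neg_left : ∀ U V, A ![-U, V] = -A ![U, V] := fun U V => by
        have := A.smul_left (-1) U V
        simpa using this
      have neg_right : ∀ U V, A ![U, -V] = -A ![U, V] := fun U V => by
        rw [A.swap, neg_left, A.swap U V]
      have bneg : ∀ U V : VField E M, ⁅U, -V⁆ = -⁅U, V⁆ := fun U V => by
        have := bracket_add_right U V (-V)
        have h0 := bracket_add_right U 0 0
        simp only [add_neg_cancel] at this
        simp only [add_zero, left_eq_add] at h0
        rw [h0] at this
        exact (neg_eq_of_add_eq_zero_right this.symm).symm
      simp only [fn12Aux]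
      rw [A.swap Z Y, A.swap Y X, A.swap X Z, A.swap Y ⁅K X, Z⁆, A.swap Z ⁅K Y, X⁆,
        A.swap X ⁅K Z, Y⁆, A.swap Z ⁅K X, Y⁆, A.swap Y ⁅K Z, X⁆, A.swap X ⁅K Y, Z⁆,
        bracket_swap X Y, bracket_swap Y Z, bracket_swap Z X]
      simp only [bneg, neg_left, map_neg]
      abel)

/-! ### `L`-structures, `L`-connections -/

/-- The standing assumptions on `L`: a vector 1-form of constant rank `n ≥ 1`, with
`½[L, L] = 0` and `Im L_z = Ker L_z` at every point. -/
structure IsLStructure (n : ℕ) (L : VForm1 E M) : Prop where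
  pos : 1 ≤ n
  rank : ∀ z : M, Module.finrank ℝ (imageAt L z) = n
  nijenhuis : (1 / 2 : ℝ) • fn11 L L = 0
  image_eq_ker : ∀ z : M, imageAt L z = kerAt L z

/-- `C` is a canonical vector field of `L`: around each point there are smooth coordinates
`(x¹,…,xⁿ; y¹,…,yⁿ)` in which `L(∂/∂xⁱ) = ∂/∂yⁱ`, `L(∂/∂yⁱ) = 0` and `C = yⁱ ∂/∂yⁱ`.
The coordinate map is the chart `e` followed by the linear isomorphism `φ : E ≃ ℝⁿ × ℝⁿ`. -/
def IsCanonicalField (n : ℕ) (L : VForm1 E M) (C : VField E M) : Prop :=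
  ∀ z : M, ∃ e ∈ IsManifold.maximalAtlas 𝓘(ℝ, E) ∞ M, z ∈ e.source ∧
    ∃ φ : E ≃L[ℝ] (Fin n → ℝ) × (Fin n → ℝ), ∀ w ∈ e.source,
      (∀ X : VField E M, φ (mfderiv 𝓘(ℝ, E) 𝓘(ℝ, E) e w ((L X) w)) =
        (0, (φ (mfderiv 𝓘(ℝ, E) 𝓘(ℝ, E) e w (X w))).1)) ∧
      φ (mfderiv 𝓘(ℝ, E) 𝓘(ℝ, E) e w (C w)) = (0, (φ (e w)).2)

/-- `Γ` is an `L`-connection: `LΓ = L` and `ΓL = -L`. -/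
def IsLConnection (L Γ : VForm1 E M) : Prop :=
  L ∘ₗ Γ = L ∧ Γ ∘ₗ L = -L

/-- The horizontal projector `h = ½(I + Γ)`. -/
def horProj (Γ : VForm1 E M) : VForm1 E M := (1 / 2 : ℝ) • (LinearMap.id + Γ)

/-- The torsion `T = ½[L, Γ]`. -/
def torsion (L Γ : VForm1 E M) : VForm E M 2 := (1 / 2 : ℝ) • fn11 L Γ

/-- The curvature `R = -½[h, h]`. -/
def curvature (Γ : VForm1 E M) : VForm E M 2 :=
  -((1 / 2 : ℝ) • fn11 (horProj Γ) (horProj Γ))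

/-- `S` is an `L`-semispray: `LS = C`. -/
def IsSemispray (L : VForm1 E M) (C S : VField E M) : Prop := L S = C

/-- `S` is the canonical `L`-semispray of `Γ`: it is an `L`-semispray and `S = hS'` for some
(equivalently, every) `L`-semispray `S'`. -/
def IsCanonicalSemispray (L : VForm1 E M) (C : VField E M) (Γ : VForm1 E M)
    (S : VField E M) : Prop :=
  IsSemispray L C S ∧ ∃ S', IsSemispray L C S' ∧ S = horProj Γ S'

/-- The strong torsion `t = T° - ½[C, Γ]`, where the potential `T° = i_{S'}T` is formed with an
`L`-semispray `S'` (on which it does not depend). -/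
def strongTorsion (L : VForm1 E M) (C : VField E M) (Γ : VForm1 E M) (S' : VField E M) :
    VForm1 E M :=
  iprod₂ S' (torsion L Γ) - (1 / 2 : ℝ) • fn01 C Γ

end Bracket

end LConn

end

open LConn

/-!
The Frölicher–Nijenhuis bracket in low degrees makes sense over any Lie ring: writing `δ` for the
Chevalley–Eilenberg coboundary and `∪` for the cup product of adjoint cochains,
`[K, L] = K ∪ L - K ∘ δL - L ∘ δK`. After expanding `[K, [L, M]]` in these operations, everything
cancels in the cyclic sum by the Jacobi identity of the Lie ring and `δ² = 0`. Identities (a) and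
(b) are the resulting Jacobi identity for `(L, h, h)` and `(h, h, h)`.

For the last identity, `Im L = Ker L` gives `K ∘ N = 0` whenever `K ∘ L = 0` and `L ∘ N = 0`, which
turns `[C, L] = -L` into the relations between `L`, `Γ` and a semispray that add up to
`[L, S] + t = Γ`. Since `Γ = 2h - I` and `[I, R] = 0`, (b) says that `[Γ, R] = 0`.
-/

namespace LConn

section LieRing

variable {V : Type*} [LieRing V]

/-- Sum over the cyclic permutations of the arguments. For maps alternating in the last two (or the
first two) of them it plays the role of the antisymmetrisation in the usual formulas. -/
def cyclicSum (f : V → V → V → V) (X Y Z : V) : V := f X Y Z + f Y Z X + f Z X Y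

/-- The Chevalley–Eilenberg coboundary of the `1`-cochain `K`, with coefficients in the adjoint
representation. -/
def coboundary₁ (K : V → V) (X Y : V) : V := ⁅K X, Y⁆ + ⁅X, K Y⁆ - K ⁅X, Y⁆

/-- The Chevalley–Eilenberg coboundary of the `2`-cochain `A`, with coefficients in the adjoint
representation. The cyclic form of the sum is the usual one when `A` is alternating. -/
def coboundary₂ (A : V → V → V) : V → V → V → V :=
  cyclicSum fun X Y Z => ⁅X, A Y Z⁆ - A ⁅X, Y⁆ Z

/-- The cup product of two `1`-cochains with respect to the Lie bracket of the coefficients. -/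
def cup₁₁ (K L : V → V) (X Y : V) : V := ⁅K X, L Y⁆ + ⁅L X, K Y⁆

/-- The cup product of a `1`-cochain and a `2`-cochain with respect to the Lie bracket of the
coefficients, `A` being thought of as alternating. -/
def cup₁₂ (K : V → V) (A : V → V → V) : V → V → V → V :=
  cyclicSum fun X Y Z => ⁅K X, A Y Z⁆

/-- The Nijenhuis–Richardson insertion of the `2`-cochain `B` into the `2`-cochain `A`, both being
thought of as alternating. -/
def insertion (A B : V → V → V) : V → V → V → V :=
  cyclicSum fun X Y Z => A (B X Y) Z

/-- The Frölicher–Nijenhuis bracket of two `1`-cochains of an arbitrary Lie ring; for vector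
`1`-forms on the Lie algebra of vector fields it is `fn11`. -/
def fnBracket₁₁ (K L : V → V) (X Y : V) : V :=
  cup₁₁ K L X Y - K (coboundary₁ L X Y) - L (coboundary₁ K X Y)

/-- The Frölicher–Nijenhuis bracket of a `1`-cochain with an alternating `2`-cochain; for vector
forms on the Lie algebra of vector fields it is `fn12`. -/
def fnBracket₁₂ (K : V → V) (A : V → V → V) (X Y Z : V) : V :=
  cup₁₂ K A X Y Z - insertion A (coboundary₁ K) X Y Z - K (coboundary₂ A X Y Z)

theorem cup₁₂_cup₁₁_jacobi (K L M : V → V) (X Y Z : V) :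
    cup₁₂ K (cup₁₁ L M) X Y Z + cup₁₂ L (cup₁₁ M K) X Y Z + cup₁₂ M (cup₁₁ K L) X Y Z = 0 := by
  have jacobi (P Q R : V) : ⁅P, ⁅Q, R⁆⁆ = ⁅Q, ⁅P, R⁆⁆ - ⁅R, ⁅P, Q⁆⁆ := by
    rw [leibniz_lie P Q R, ← lie_skew ⁅P, Q⁆ R]
    abel
  simp only [cup₁₂, cup₁₁, cyclicSum, lie_add]
  rw [jacobi (K X) (L Y) (M Z), jacobi (K X) (M Y) (L Z), jacobi (K Y) (L Z) (M X),
    jacobi (K Y) (M Z) (L X), jacobi (K Z) (L X) (M Y), jacobi (K Z) (M X) (L Y)]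
  simp only [← lie_skew (M _) (K _), ← lie_skew (L _) (K _), lie_neg]
  abel

theorem coboundary₂_cup₁₁ (K L : V → V) (X Y Z : V) :
    coboundary₂ (cup₁₁ K L) X Y Z
      = -cup₁₂ K (coboundary₁ L) X Y Z - cup₁₂ L (coboundary₁ K) X Y Z := by
  simp only [coboundary₂, cup₁₂, cup₁₁, coboundary₁, cyclicSum, lie_add, lie_sub]
  have jacobi (P Q R : V) : ⁅P, ⁅Q, R⁆⁆ = -⁅Q, ⁅R, P⁆⁆ - ⁅R, ⁅P, Q⁆⁆ := by
    rw [leibniz_lie P Q R, ← lie_skew ⁅P, Q⁆ R, ← lie_skew P R, lie_neg]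
    abel
  rw [jacobi X (K Y) (L Z), jacobi X (L Y) (K Z), jacobi Y (K Z) (L X),
    jacobi Y (L Z) (K X), jacobi Z (K X) (L Y), jacobi Z (L X) (K Y)]
  rw [← lie_skew (L Z) (K ⁅X, Y⁆), ← lie_skew (K Z) (L ⁅X, Y⁆),
     ← lie_skew (L X) (K ⁅Y, Z⁆), ← lie_skew (K X) (L ⁅Y, Z⁆),
     ← lie_skew (L Y) (K ⁅Z, X⁆), ← lie_skew (K Y) (L ⁅Z, X⁆)]
  abel

theorem coboundary₂_coboundary₁ (K : V →+ V) (X Y Z : V) :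
    coboundary₂ (coboundary₁ K) X Y Z = 0 := by
  have jacobi (P Q R : V) : ⁅P, ⁅Q, R⁆⁆ + ⁅Q, ⁅R, P⁆⁆ + ⁅R, ⁅P, Q⁆⁆ = 0 := lie_jacobi P Q R
  have expand : coboundary₂ (coboundary₁ K) X Y Z =
      (⁅K X, ⁅Y, Z⁆⁆ + ⁅Y, ⁅Z, K X⁆⁆ + ⁅Z, ⁅K X, Y⁆⁆)
        + (⁅X, ⁅K Y, Z⁆⁆ + ⁅K Y, ⁅Z, X⁆⁆ + ⁅Z, ⁅X, K Y⁆⁆)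
        + (⁅X, ⁅Y, K Z⁆⁆ + ⁅Y, ⁅K Z, X⁆⁆ + ⁅K Z, ⁅X, Y⁆⁆)
        - K (⁅X, ⁅Y, Z⁆⁆ + ⁅Y, ⁅Z, X⁆⁆ + ⁅Z, ⁅X, Y⁆⁆) := by
    simp only [coboundary₂, coboundary₁, cyclicSum, lie_add, lie_sub, map_add]
    rw [← lie_skew ⁅X, Y⁆ Z, ← lie_skew ⁅Y, Z⁆ X, ← lie_skew ⁅Z, X⁆ Y, ← lie_skew ⁅X, Y⁆ (K Z),
      ← lie_skew ⁅Y, Z⁆ (K X), ← lie_skew ⁅Z, X⁆ (K Y), ← lie_skew (K ⁅X, Y⁆) Z,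
      ← lie_skew (K ⁅Y, Z⁆) X, ← lie_skew (K ⁅Z, X⁆) Y]
    simp only [map_neg]
    abel
  simp only [expand, jacobi, map_zero, add_zero, sub_zero]

theorem coboundary₂_comp (K : V →+ V) (B : V → V → V) (X Y Z : V) :
    coboundary₂ (fun X Y => K (B X Y)) X Y Z
      = K (coboundary₂ B X Y Z) - insertion (coboundary₁ K) B X Y Z - cup₁₂ K B X Y Z := by
  simp only [coboundary₂, insertion, coboundary₁, cup₁₂, cyclicSum, map_add, map_sub]
  rw [← lie_skew X (B Y Z), ← lie_skew Y (B Z X), ← lie_skew Z (B X Y)]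
  simp only [map_neg]
  rw [← lie_skew X (K _), ← lie_skew Y (K _), ← lie_skew Z (K _),
    ← lie_skew (K X) (B _ _), ← lie_skew (K Y) (B _ _), ← lie_skew (K Z) (B _ _)]
  abel

theorem insertion_cup₁₁ (K L : V → V) (B : V → V → V) (X Y Z : V) :
    insertion (cup₁₁ K L) B X Y Z
      = -cup₁₂ K (fun X Y => L (B X Y)) X Y Z - cup₁₂ L (fun X Y => K (B X Y)) X Y Z := by
  simp only [insertion, cup₁₁, cup₁₂, cyclicSum]
  simp only [← lie_skew (K (B _ _)), ← lie_skew (L (B _ _))]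
  abel

theorem coboundary₂_fnBracket₁₁ (K L : V →+ V) (X Y Z : V) :
    coboundary₂ (fnBracket₁₁ K L) X Y Z
      = insertion (coboundary₁ K) (coboundary₁ L) X Y Z
        + insertion (coboundary₁ L) (coboundary₁ K) X Y Z := by
  have split : coboundary₂ (fnBracket₁₁ K L) X Y Z = coboundary₂ (cup₁₁ K L) X Y Z
      - coboundary₂ (fun X Y => K (coboundary₁ L X Y)) X Y Z
      - coboundary₂ (fun X Y => L (coboundary₁ K X Y)) X Y Z := by
    simp only [coboundary₂, cyclicSum, fnBracket₁₁, lie_sub]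
    abel
  rw [split, coboundary₂_cup₁₁, coboundary₂_comp, coboundary₂_comp, coboundary₂_coboundary₁,
    coboundary₂_coboundary₁, map_zero, map_zero]
  abel

theorem fnBracket₁₂_fnBracket₁₁ (K L M : V →+ V) (X Y Z : V) :
    fnBracket₁₂ K (fnBracket₁₁ L M) X Y Z =
      cup₁₂ K (cup₁₁ L M) X Y Z
        - cup₁₂ K (fun X Y => L (coboundary₁ M X Y)) X Y Z
        - cup₁₂ K (fun X Y => M (coboundary₁ L X Y)) X Y Z
        + cup₁₂ L (fun X Y => M (coboundary₁ K X Y)) X Y Z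
        + cup₁₂ M (fun X Y => L (coboundary₁ K X Y)) X Y Z
        + L (insertion (coboundary₁ M) (coboundary₁ K) X Y Z)
        + M (insertion (coboundary₁ L) (coboundary₁ K) X Y Z)
        - K (insertion (coboundary₁ L) (coboundary₁ M) X Y Z)
        - K (insertion (coboundary₁ M) (coboundary₁ L) X Y Z) := by
  have cup_split : cup₁₂ K (fnBracket₁₁ L M) X Y Z = cup₁₂ K (cup₁₁ L M) X Y Z
      - cup₁₂ K (fun X Y => L (coboundary₁ M X Y)) X Y Z
      - cup₁₂ K (fun X Y => M (coboundary₁ L X Y)) X Y Z := by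
    simp only [cup₁₂, cyclicSum, fnBracket₁₁, lie_sub]
    abel
  have insertion_split : insertion (fnBracket₁₁ L M) (coboundary₁ K) X Y Z =
      insertion (cup₁₁ L M) (coboundary₁ K) X Y Z
        - L (insertion (coboundary₁ M) (coboundary₁ K) X Y Z)
        - M (insertion (coboundary₁ L) (coboundary₁ K) X Y Z) := by
    simp only [insertion, cyclicSum, fnBracket₁₁, map_add]
    abel
  rw [fnBracket₁₂, cup_split, insertion_split, insertion_cup₁₁, coboundary₂_fnBracket₁₁, map_add]
  abel

theorem fnBracket₁₂_fnBracket₁₁_jacobi (K L M : V →+ V) (X Y Z : V) :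
    fnBracket₁₂ K (fnBracket₁₁ L M) X Y Z + fnBracket₁₂ L (fnBracket₁₁ M K) X Y Z
      + fnBracket₁₂ M (fnBracket₁₁ K L) X Y Z = 0 := by
  rw [← cup₁₂_cup₁₁_jacobi K L M X Y Z]
  simp only [fnBracket₁₂_fnBracket₁₁]
  abel

end LieRing

section VectorFields

variable {E M : Type*} [NormedAddCommGroup E] [NormedSpace ℝ E]
  [TopologicalSpace M] [ChartedSpace E M] [IsManifold 𝓘(ℝ, E) ∞ M]

instance isManifold_minSmoothness (k : WithTop ℕ∞) [ENat.LEInfty k] :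
    IsManifold 𝓘(ℝ, E) (minSmoothness ℝ k) M := by
  rw [minSmoothness_of_isRCLikeNormedField]
  exact IsManifold.of_le (n := ∞) ENat.LEInfty.out

theorem VField.contMDiffAt_minSmoothness (X : VField E M) (k : WithTop ℕ∞) [ENat.LEInfty k]
    (z : M) : ContMDiffAt 𝓘(ℝ, E) 𝓘(ℝ, E).tangent (minSmoothness ℝ k)
      (fun w => (X w : TangentBundle 𝓘(ℝ, E) M)) z := by
  rw [minSmoothness_of_isRCLikeNormedField]
  exact (X.contMDiff z).of_le ENat.LEInfty.out

variable [FiniteDimensional ℝ E]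

noncomputable instance : LieRing (VField E M) where
  add_lie := bracket_add_left
  lie_add := bracket_add_right
  lie_self X := eq_zero_of_eq_neg (bracket_swap X X)
  leibniz_lie X Y Z := by
    have : CompleteSpace E := FiniteDimensional.complete ℝ E
    ext z
    exact VectorField.leibniz_identity_mlieBracket_apply (X.contMDiffAt_minSmoothness 2 z)
      (Y.contMDiffAt_minSmoothness 2 z) (Z.contMDiffAt_minSmoothness 2 z)

noncomputable instance : LieAlgebra ℝ (VField E M) where
  lie_smul c X Y := by
    have : CompleteSpace E := FiniteDimensional.complete ℝ E
    ext z
    exact VectorField.mlieBracket_const_smul_right Y.mdifferentiableAt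

end VectorFields

section VectorForms

variable {E M : Type*} [NormedAddCommGroup E] [NormedSpace ℝ E]
  [TopologicalSpace M] [ChartedSpace E M] [IsManifold 𝓘(ℝ, E) ∞ M]

theorem VForm.ext₂ {A B : VForm E M 2} (h : ∀ X Y, A ![X, Y] = B ![X, Y]) : A = B := by
  ext1 m
  have hm : m = ![m 0, m 1] := by ext1 i; fin_cases i <;> rfl
  rw [hm, h]

theorem VForm.ext₃ {A B : VForm E M 3} (h : ∀ X Y Z, A ![X, Y, Z] = B ![X, Y, Z]) : A = B := by
  ext1 m
  have hm : m = ![m 0, m 1, m 2] := by ext1 i; fin_cases i <;> rfl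
  rw [hm, h]

theorem VForm.neg_left (A : VForm E M 2) (X Y : VField E M) : A ![-X, Y] = -A ![X, Y] := by
  simpa only [neg_one_smul] using A.smul_left (-1) X Y

theorem VForm.sub_left (A : VForm E M 2) (X X' Y : VField E M) :
    A ![X - X', Y] = A ![X, Y] - A ![X', Y] := by
  rw [sub_eq_add_neg, A.add_left, A.neg_left, ← sub_eq_add_neg]

variable [FiniteDimensional ℝ E]

theorem fn11_apply (K L : VForm1 E M) (X Y : VField E M) :
    fn11 K L ![X, Y] = fnBracket₁₁ K L X Y := by
  simp only [fn11, VForm.mk₂_apply, fnBracket₁₁, cup₁₁, coboundary₁, map_add, map_sub]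
  abel

theorem fn12_apply (K : VForm1 E M) (A : VForm E M 2) (X Y Z : VField E M) :
    fn12 K A ![X, Y, Z] = fnBracket₁₂ K (fun X Y => A ![X, Y]) X Y Z := by
  have transpose (P Q R : VField E M) : A ![P, ⁅K Q, R⁆] = A ![⁅R, K Q⁆, P] := by
    rw [A.swap, ← A.neg_left, lie_skew]
  simp only [fn12, VForm.mk₃_apply, fn12Aux, fnBracket₁₂, cup₁₂, insertion, coboundary₂,
    coboundary₁, cyclicSum, transpose, A.sub_left, A.add_left, map_add, map_sub]
  abel

theorem fn12_jacobi (K L N : VForm1 E M) :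
    fn12 K (fn11 L N) + fn12 L (fn11 N K) + fn12 N (fn11 K L) = 0 :=
  VForm.ext₃ fun X Y Z => by
    simp only [AlternatingMap.add_apply, fn12_apply, fn11_apply]
    exact fnBracket₁₂_fnBracket₁₁_jacobi K.toAddMonoidHom L.toAddMonoidHom N.toAddMonoidHom X Y Z

theorem fn11_comm (K L : VForm1 E M) : fn11 K L = fn11 L K :=
  VForm.ext₂ fun X Y => by
    simp only [fn11_apply, fnBracket₁₁, cup₁₁]
    abel

theorem fn11_id (L : VForm1 E M) : fn11 L LinearMap.id = 0 :=
  VForm.ext₂ fun X Y => by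
    simp only [fn11_apply, fnBracket₁₁, cup₁₁, coboundary₁, LinearMap.id_apply,
      AlternatingMap.zero_apply, map_add, map_sub]
    abel

theorem fn12_id (A : VForm E M 2) : fn12 LinearMap.id A = 0 :=
  VForm.ext₃ fun X Y Z => by
    simp only [fn12_apply, fnBracket₁₂, cup₁₂, insertion, coboundary₂, coboundary₁, cyclicSum,
      LinearMap.id_apply, add_sub_cancel_right, AlternatingMap.zero_apply]
    abel

theorem fn11_add_right (K L N : VForm1 E M) : fn11 K (L + N) = fn11 K L + fn11 K N :=
  VForm.ext₂ fun X Y => by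
    simp only [fn11_apply, fnBracket₁₁, cup₁₁, coboundary₁, AlternatingMap.add_apply,
      LinearMap.add_apply, add_lie, lie_add, map_add, map_sub]
    abel

theorem fn11_smul_right (c : ℝ) (K L : VForm1 E M) : fn11 K (c • L) = c • fn11 K L :=
  VForm.ext₂ fun X Y => by
    simp only [fn11_apply, fnBracket₁₁, cup₁₁, coboundary₁, AlternatingMap.smul_apply,
      LinearMap.smul_apply, smul_lie, lie_smul, LinearMap.map_smul_of_tower, smul_add, smul_sub,
      map_add, map_sub]

theorem fn12_add_left (K L : VForm1 E M) (A : VForm E M 2) :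
    fn12 (K + L) A = fn12 K A + fn12 L A :=
  VForm.ext₃ fun X Y Z => by
    simp only [fn12_apply, fnBracket₁₂, cup₁₂, insertion, coboundary₁, cyclicSum,
      AlternatingMap.add_apply, LinearMap.add_apply, add_lie, lie_add, A.sub_left, A.add_left]
    abel

theorem fn12_smul_right (c : ℝ) (K : VForm1 E M) (A : VForm E M 2) :
    fn12 K (c • A) = c • fn12 K A :=
  VForm.ext₃ fun X Y Z => by
    simp only [fn12_apply, fnBracket₁₂, cup₁₂, insertion, coboundary₂, cyclicSum,
      AlternatingMap.smul_apply, lie_smul, LinearMap.map_smul_of_tower, smul_add, smul_sub,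
      map_add, map_sub]

theorem fn12_fn11_self_add (K L : VForm1 E M) :
    fn12 L (fn11 K K) + (2 : ℝ) • fn12 K (fn11 L K) = 0 := by
  rw [← fn12_jacobi L K K, fn11_comm K L, two_smul, add_assoc]

theorem fn12_fn11_self (K : VForm1 E M) : fn12 K (fn11 K K) = 0 := by
  have three_smul_eq : (3 : ℝ) • fn12 K (fn11 K K) = 0 := by
    rw [← fn12_fn11_self_add K K]
    module
  exact (smul_eq_zero.1 three_smul_eq).resolve_left (by norm_num)

theorem torsion_eq_fn11_horProj (L Γ : VForm1 E M) : torsion L Γ = fn11 L (horProj Γ) := by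
  rw [torsion, horProj, fn11_smul_right, fn11_add_right, fn11_id, zero_add]

theorem fn12_curvature (L Γ : VForm1 E M) :
    fn12 L (curvature Γ) = fn12 (horProj Γ) (torsion L Γ) := by
  rw [curvature, ← neg_smul, fn12_smul_right, torsion_eq_fn11_horProj,
    eq_neg_of_add_eq_zero_left (fn12_fn11_self_add (horProj Γ) L)]
  module

theorem fn12_horProj_curvature (Γ : VForm1 E M) : fn12 (horProj Γ) (curvature Γ) = 0 := by
  rw [curvature, ← neg_smul, fn12_smul_right, fn12_fn11_self, smul_zero]

theorem fn12_self_curvature (Γ : VForm1 E M) : fn12 Γ (curvature Γ) = 0 := by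
  have two_horProj : horProj Γ + horProj Γ = LinearMap.id + Γ := by
    rw [horProj]
    module
  have h := congrArg (fn12 · (curvature Γ)) two_horProj
  simpa only [fn12_add_left, fn12_horProj_curvature, fn12_id, add_zero, zero_add] using h.symm

theorem fn01_apply (X : VField E M) (K : VForm1 E M) (Y : VField E M) :
    fn01 X K Y = ⁅X, K Y⁆ - K ⁅X, Y⁆ := rfl

theorem fn01_add_left (X Y : VField E M) (K : VForm1 E M) :
    fn01 (X + Y) K = fn01 X K + fn01 Y K := by
  ext1 Z
  simp only [fn01_apply, LinearMap.add_apply, add_lie, map_add]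
  abel

theorem fn01_zero (X : VField E M) : fn01 X (0 : VForm1 E M) = 0 := by
  ext1 Y
  simp only [fn01_apply, LinearMap.zero_apply, lie_zero, sub_zero]

theorem fn01_comp (X : VField E M) (K L : VForm1 E M) :
    fn01 X (K ∘ₗ L) = fn01 X K ∘ₗ L + K ∘ₗ fn01 X L := by
  ext1 Y
  simp only [fn01_apply, LinearMap.add_apply, LinearMap.comp_apply, map_sub]
  abel

theorem iprod₂_fn11 (X : VField E M) (K L : VForm1 E M) :
    iprod₂ X (fn11 K L) =
      fn01 (K X) L + fn01 (L X) K - K ∘ₗ fn01 X L - L ∘ₗ fn01 X K := by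
  ext1 Y
  change fn11 K L ![X, Y] = _
  simp only [fn11_apply, fnBracket₁₁, cup₁₁, coboundary₁, fn01_apply, LinearMap.add_apply,
    LinearMap.sub_apply, LinearMap.comp_apply, map_add, map_sub]
  abel

theorem comp_fn01_self_of_fn11_self {L : VForm1 E M} (hLL : fn11 L L = 0) (X : VField E M) :
    L ∘ₗ fn01 X L = fn01 (L X) L := by
  have h := iprod₂_fn11 X L L
  have two_smul_sub : (2 : ℝ) • (fn01 (L X) L - L ∘ₗ fn01 X L) = 0 := by
    rw [hLL] at h
    refine Eq.trans ?_ h.symm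
    module
  exact (sub_eq_zero.1 ((smul_eq_zero.1 two_smul_sub).resolve_left two_ne_zero)).symm

end VectorForms

section Tensoriality

variable {E M : Type*} [NormedAddCommGroup E] [NormedSpace ℝ E]
  [TopologicalSpace M] [ChartedSpace E M] [IsManifold 𝓘(ℝ, E) ∞ M]

theorem VField.sum_apply {ι : Type*} (s : Finset ι) (X : ι → VField E M) (z : M) :
    (∑ i ∈ s, X i) z = ∑ i ∈ s, X i z := map_sum (evalAt z) X s

variable [FiniteDimensional ℝ E] [T2Space M]

theorem VField.exists_smul_eq_sum_smul {X : VField E M} {z : M} (hX : X z = 0) :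
    ∃ (g : Fun E M) (f : Fin (Module.finrank ℝ E) → Fun E M)
      (e : Fin (Module.finrank ℝ E) → VField E M),
      g z = 1 ∧ (∀ i, f i z = 0) ∧ g • X = ∑ i, f i • e i := by
  let t := trivializationAt E (TangentSpace 𝓘(ℝ, E) : M → Type _) z
  let b := Module.finBasis ℝ E
  let ψ : SmoothBumpFunction 𝓘(ℝ, E) z := Classical.arbitrary _
  have hψ : tsupport ψ ⊆ t.baseSet := ψ.tsupport_subset_chartAt_source
  have contMDiff_coeff (i) : ContMDiff 𝓘(ℝ, E) 𝓘(ℝ, ℝ) ∞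
      fun w => ψ w • t.localFrameCoeff 𝓘(ℝ, E) b i w (X w) :=
    contMDiff_of_tsupport fun w hw => ψ.contMDiff.contMDiffAt.smul <|
      contMDiffAt_localFrameCoeff (e := t) b (hψ (tsupport_smul_subset_left _ _ hw))
        (X.contMDiff w) i
  refine ⟨⟨fun w => ψ w * ψ w, ψ.contMDiff.mul ψ.contMDiff⟩, fun i => ⟨_, contMDiff_coeff i⟩,
    fun i => ⟨fun w => ψ w • t.localFrame b i w,
      ContMDiffOn.smul_section_of_tsupport ψ.contMDiff.contMDiffOn t.open_baseSet hψ
        (t.contMDiffOn_localFrame_baseSet ∞ b i)⟩, ?_, fun i => ?_, ?_⟩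
  · change ψ z * ψ z = 1
    rw [ψ.eq_one, mul_one]
  · change ψ z • t.localFrameCoeff 𝓘(ℝ, E) b i z (X z) = 0
    rw [hX, map_zero, smul_zero]
  · ext w
    rw [VField.sum_apply]
    change (ψ w * ψ w) • X w = ∑ i, (ψ w • t.localFrameCoeff 𝓘(ℝ, E) b i w (X w)) •
      ψ w • t.localFrame b i w
    by_cases hw : w ∈ t.baseSet
    · conv_lhs => rw [t.eq_sum_localFrameCoeff_smul (I := 𝓘(ℝ, E)) (b := b) hw (s := X)]
      simp only [Finset.smul_sum, smul_smul, smul_eq_mul, mul_right_comm]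
    · have hψw : ψ w = 0 := image_eq_zero_of_notMem_tsupport fun h => hw (hψ h)
      simp only [hψw, zero_mul, zero_smul, smul_zero, Finset.sum_const_zero]

theorem VForm1.apply_eq_zero_of_apply_eq_zero (K : VForm1 E M) {X : VField E M} {z : M}
    (hX : X z = 0) : K X z = 0 := by
  obtain ⟨g, f, e, hg, hf, hgX⟩ := VField.exists_smul_eq_sum_smul hX
  have h := congrArg (fun Y => K Y z) hgX
  simpa only [map_smul, map_sum, smul_apply, VField.sum_apply, hg, hf, one_smul, zero_smul,
    Finset.sum_const_zero] using h

theorem VForm1.apply_eq_of_apply_eq (K : VForm1 E M) {X Y : VField E M} {z : M}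
    (h : X z = Y z) : K X z = K Y z := by
  have hK : K (X - Y) z = 0 := K.apply_eq_zero_of_apply_eq_zero (sub_eq_zero.2 h)
  rw [map_sub] at hK
  exact sub_eq_zero.1 hK

end Tensoriality

section AlmostTangent

variable {E M : Type*} [NormedAddCommGroup E] [NormedSpace ℝ E]
  [TopologicalSpace M] [ChartedSpace E M] [IsManifold 𝓘(ℝ, E) ∞ M]

/-- Almost tangent structures: vector 1-forms `L` with `Im L_z = Ker L_z` at every point. Neither
constancy of the rank nor integrability `[L, L] = 0` is part of the notion. -/
def IsAlmostTangent (L : VForm1 E M) : Prop := ∀ z : M, imageAt L z = kerAt L z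

variable {L Γ : VForm1 E M} {C S S' : VField E M}

theorem horProj_comp_of_isLConnection (hΓ : IsLConnection L Γ) :
    horProj Γ ∘ₗ L = 0 := by
  rw [horProj, LinearMap.smul_comp, LinearMap.add_comp, hΓ.2, LinearMap.id_comp, add_neg_cancel,
    smul_zero]

variable [FiniteDimensional ℝ E]

theorem IsLStructure.isAlmostTangent {n : ℕ} (hL : IsLStructure n L) :
    IsAlmostTangent L := hL.image_eq_ker

theorem IsLStructure.fn11_self {n : ℕ} (hL : IsLStructure n L) :
    fn11 L L = 0 := (smul_eq_zero.1 hL.nijenhuis).resolve_left (by norm_num)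

theorem IsSemispray.comp_fn01_self (hS : IsSemispray L C S) (hLL : fn11 L L = 0)
    (hC : fn01 C L = -L) : L ∘ₗ fn01 S L = -L := by
  rw [comp_fn01_self_of_fn11_self hLL, hS, hC]

variable [T2Space M]

theorem IsAlmostTangent.comp_self (hL : IsAlmostTangent L) : L ∘ₗ L = 0 := by
  ext X z
  obtain ⟨Y, hY, hYX⟩ : L X z ∈ kerAt L z := hL z ▸ ⟨X, rfl⟩
  exact (L.apply_eq_of_apply_eq hYX).symm.trans hY

theorem IsAlmostTangent.apply_eq_zero (hL : IsAlmostTangent L)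
    {K : VForm1 E M} (hK : K ∘ₗ L = 0) {X : VField E M} (hX : L X = 0) : K X = 0 := by
  ext z
  have hz : X z ∈ kerAt L z := ⟨X, congrArg (fun Y : VField E M => Y z) hX, rfl⟩
  obtain ⟨Y, hY⟩ : X z ∈ imageAt L z := hL z ▸ hz
  rw [← K.apply_eq_of_apply_eq hY]
  exact congrArg (fun N : VForm1 E M => N Y z) hK

theorem IsAlmostTangent.comp_eq_zero (hL : IsAlmostTangent L)
    {K N : VForm1 E M} (hK : K ∘ₗ L = 0) (hN : L ∘ₗ N = 0) : K ∘ₗ N = 0 := by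
  ext1 X
  exact hL.apply_eq_zero hK (LinearMap.congr_fun hN X)

theorem IsCanonicalSemispray.eq_horProj (hS : IsCanonicalSemispray L C Γ S)
    (hL : IsAlmostTangent L) (hΓ : IsLConnection L Γ) (hS' : IsSemispray L C S') :
    S = horProj Γ S' := by
  obtain ⟨-, S'', hS'', rfl⟩ := hS
  have hker : L (S'' - S') = 0 := by rw [map_sub, hS'', hS', sub_self]
  rw [← sub_eq_zero, ← map_sub]
  exact hL.apply_eq_zero (horProj_comp_of_isLConnection hΓ) hker

theorem IsSemispray.fn01_comp_self (hS : IsSemispray L C S) (hL : IsAlmostTangent L)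
    (hLL : fn11 L L = 0) (hC : fn01 C L = -L) : fn01 S L ∘ₗ L = L := by
  have leibniz := fn01_comp S L L
  rw [hL.comp_self, fn01_zero, hS.comp_fn01_self hLL hC] at leibniz
  exact add_neg_eq_zero.1 leibniz.symm

theorem IsSemispray.comp_fn01_connection (hS : IsSemispray L C S) (hL : IsAlmostTangent L)
    (hLL : fn11 L L = 0) (hC : fn01 C L = -L) (hΓ : IsLConnection L Γ) :
    L ∘ₗ fn01 S Γ = LinearMap.id - Γ := by
  have leibniz := fn01_comp S L Γ
  have vanish : (fn01 S L - LinearMap.id) ∘ₗ (LinearMap.id - Γ) = 0 :=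
    hL.comp_eq_zero
      (by rw [LinearMap.sub_comp, hS.fn01_comp_self hL hLL hC, LinearMap.id_comp, sub_self])
      (by rw [LinearMap.comp_sub, hΓ.1, LinearMap.comp_id, sub_self])
  rw [hΓ.1] at leibniz
  rw [LinearMap.sub_comp, LinearMap.comp_sub, LinearMap.comp_id, LinearMap.id_comp,
    sub_eq_zero] at vanish
  rw [← vanish, eq_sub_iff_add_eq', ← leibniz]

theorem IsSemispray.connection_comp_fn01 (hS : IsSemispray L C S) (hL : IsAlmostTangent L)
    (hLL : fn11 L L = 0) (hC : fn01 C L = -L) (hΓ : IsLConnection L Γ) :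
    Γ ∘ₗ fn01 S L = -fn01 S L - LinearMap.id - Γ := by
  have vanish : (Γ + LinearMap.id) ∘ₗ (fn01 S L + LinearMap.id) = 0 :=
    hL.comp_eq_zero
      (by rw [LinearMap.add_comp, hΓ.2, LinearMap.id_comp, neg_add_cancel])
      (by rw [LinearMap.comp_add, hS.comp_fn01_self hLL hC, LinearMap.comp_id, neg_add_cancel])
  rw [LinearMap.add_comp, LinearMap.comp_add, LinearMap.comp_id, LinearMap.id_comp] at vanish
  rw [← sub_eq_zero, ← vanish]
  abel

theorem fn10_horProj_add_strongTorsion (hS : IsSemispray L C S) (hL : IsAlmostTangent L)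
    (hLL : fn11 L L = 0) (hC : fn01 C L = -L) (hΓ : IsLConnection L Γ) :
    fn10 L (horProj Γ S) + strongTorsion L C Γ S = Γ := by
  have two_horProj : horProj Γ S + horProj Γ S = S + Γ S := by
    rw [horProj, LinearMap.smul_apply, LinearMap.add_apply, LinearMap.id_apply]
    module
  have two_fn01 : fn01 (horProj Γ S) L + fn01 (horProj Γ S) L = fn01 S L + fn01 (Γ S) L := by
    rw [← fn01_add_left, two_horProj, fn01_add_left]
  have two_torsion : iprod₂ S (fn11 L Γ) =
      fn01 C Γ + (fn01 (horProj Γ S) L + fn01 (horProj Γ S) L) + (Γ + Γ) := by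
    rw [iprod₂_fn11, hS, hS.comp_fn01_connection hL hLL hC hΓ,
      hS.connection_comp_fn01 hL hLL hC hΓ, two_fn01]
    abel
  have smul_iprod : iprod₂ S (torsion L Γ) = (1 / 2 : ℝ) • iprod₂ S (fn11 L Γ) := rfl
  rw [fn10, strongTorsion, smul_iprod, two_torsion]
  module

theorem fn12_fn10_curvature (hL : IsAlmostTangent L) (hLL : fn11 L L = 0)
    (hΓ : IsLConnection L Γ) (hC : fn01 C L = -L) (hS : IsCanonicalSemispray L C Γ S)
    (hS' : IsSemispray L C S') :
    fn12 (fn10 L S) (curvature Γ) = -fn12 (strongTorsion L C Γ S') (curvature Γ) := by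
  rw [← add_eq_zero_iff_eq_neg, ← fn12_add_left, hS.eq_horProj hL hΓ hS',
    fn10_horProj_add_strongTorsion hS' hL hLL hC hΓ, fn12_self_curvature]

end AlmostTangent

section Coordinates

open VectorField Filter Topology

theorem lieBracket_clm_comp {E : Type*} [NormedAddCommGroup E] [NormedSpace ℝ E] {A B : E →L[ℝ] E}
    (hAB : A ∘L B = B) (hBA : B ∘L A = 0) {Y : E → E} {p : E} (hY : DifferentiableAt ℝ Y p) :
    lieBracket ℝ A (fun q => B (Y q)) p - B (lieBracket ℝ A Y p) = -B (Y p) := by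
  have fderiv_comp : fderiv ℝ (fun q => B (Y q)) p = B ∘L fderiv ℝ Y p :=
    (B.hasFDerivAt.comp p hY.hasFDerivAt).fderiv
  have hAB' (v : E) : A (B v) = B v := DFunLike.congr_fun hAB v
  have hBA' (v : E) : B (A v) = 0 := DFunLike.congr_fun hBA v
  simp only [lieBracket, fderiv_comp, A.fderiv, map_sub, hAB', hBA',
    ContinuousLinearMap.comp_apply]
  abel

variable {E M : Type*} [NormedAddCommGroup E] [NormedSpace ℝ E]
  [TopologicalSpace M] [ChartedSpace E M] {e : OpenPartialHomeomorph M E}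

theorem mdifferentiable_of_mem_maximalAtlas (he : e ∈ IsManifold.maximalAtlas 𝓘(ℝ, E) ∞ M) :
    e.MDifferentiable 𝓘(ℝ, E) 𝓘(ℝ, E) :=
  ⟨(contMDiffOn_of_mem_maximalAtlas he).mdifferentiableOn (by simp),
    (contMDiffOn_symm_of_mem_maximalAtlas he).mdifferentiableOn (by simp)⟩

theorem isInvertible_mfderiv_symm (he : e ∈ IsManifold.maximalAtlas 𝓘(ℝ, E) ∞ M) {q : E}
    (hq : q ∈ e.target) : (mfderiv 𝓘(ℝ, E) 𝓘(ℝ, E) e.symm q).IsInvertible :=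
  ⟨(mdifferentiable_of_mem_maximalAtlas he).symm.mfderiv hq, rfl⟩

variable [IsManifold 𝓘(ℝ, E) ∞ M]

/-- The coordinate expression of a vector field in a chart `e`, as a vector field on the model
space. It is meaningful on `e.target` only. -/
noncomputable def coordRep (e : OpenPartialHomeomorph M E) : VField E M →ₗ[ℝ] E → E where
  toFun X := mpullback 𝓘(ℝ, E) 𝓘(ℝ, E) e.symm X
  map_add' _ _ := funext fun q => map_add (mfderiv 𝓘(ℝ, E) 𝓘(ℝ, E) e.symm q).inverse _ _
  map_smul' c _ := funext fun q => map_smul (mfderiv 𝓘(ℝ, E) 𝓘(ℝ, E) e.symm q).inverse c _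

theorem coordRep_apply (he : e ∈ IsManifold.maximalAtlas 𝓘(ℝ, E) ∞ M) (X : VField E M) {z : M}
    (hz : z ∈ e.source) : coordRep e X (e z) = mfderiv 𝓘(ℝ, E) 𝓘(ℝ, E) e z (X z) := by
  refine (isInvertible_mfderiv_symm he (e.map_source hz)).inverse_apply_eq.2 ?_
  have symm_comp := (mdifferentiable_of_mem_maximalAtlas he).symm_comp_deriv hz
  have left_inv : (X (e.symm (e z)) : E) = X z := congrArg (fun w => (X w : E)) (e.left_inv hz)
  exact left_inv.trans (DFunLike.congr_fun symm_comp (X z)).symm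

theorem coordRep_injective_at (he : e ∈ IsManifold.maximalAtlas 𝓘(ℝ, E) ∞ M) {X Y : VField E M}
    {z : M} (hz : z ∈ e.source) (h : coordRep e X (e z) = coordRep e Y (e z)) : X z = Y z := by
  rw [coordRep_apply he X hz, coordRep_apply he Y hz] at h
  exact (mdifferentiable_of_mem_maximalAtlas he).mfderiv_injective hz h

theorem differentiableAt_coordRep [CompleteSpace E]
    (he : e ∈ IsManifold.maximalAtlas 𝓘(ℝ, E) ∞ M) (X : VField E M) {q : E}
    (hq : q ∈ e.target) : DifferentiableAt ℝ (coordRep e X) q := by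
  have h := ((X.contMDiff (e.symm q)).of_le (m := 1)
    ENat.LEInfty.out).mpullback_vectorField_preimage (contMDiffAt_symm_of_mem_maximalAtlas he hq)
    (isInvertible_mfderiv_symm he hq) (by rw [one_add_one_eq_two]; exact ENat.LEInfty.out)
  exact (contMDiffAt_vectorSpace_iff_contDiffAt.1 h).differentiableAt one_ne_zero

theorem coordRep_lie [FiniteDimensional ℝ E] (he : e ∈ IsManifold.maximalAtlas 𝓘(ℝ, E) ∞ M)
    (X Y : VField E M) {q : E} (hq : q ∈ e.target) :
    coordRep e ⁅X, Y⁆ q = lieBracket ℝ (coordRep e X) (coordRep e Y) q := by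
  have : CompleteSpace E := FiniteDimensional.complete ℝ E
  have h := mpullback_mlieBracket (I := 𝓘(ℝ, E)) (X.mdifferentiableAt (x := e.symm q))
    (Y.mdifferentiableAt (x := e.symm q)) (contMDiffAt_symm_of_mem_maximalAtlas he hq)
    (by rw [minSmoothness_of_isRCLikeNormedField]; exact ENat.LEInfty.out)
  rw [← mlieBracketWithin_univ (I := 𝓘(ℝ, E)) (M := E),
    mlieBracketWithin_eq_lieBracketWithin] at h
  rw [← lieBracketWithin_univ]
  exact h

/-- With `φ : E ≃ F × F`, the operators are `B (x, y) = (0, x)` and `A (x, y) = (0, y)`. -/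
theorem IsCanonicalField.exists_coordRep_eventuallyEq [FiniteDimensional ℝ E] {n : ℕ}
    {L : VForm1 E M} {C : VField E M} (hC : IsCanonicalField n L C) (z : M) :
    ∃ e ∈ IsManifold.maximalAtlas 𝓘(ℝ, E) ∞ M, z ∈ e.source ∧
      ∃ A B : E →L[ℝ] E, A ∘L B = B ∧ B ∘L A = 0 ∧ coordRep e C =ᶠ[𝓝 (e z)] A ∧
        ∀ X, coordRep e (L X) =ᶠ[𝓝 (e z)] fun q => B (coordRep e X q) := by
  obtain ⟨e, he, hz, φ, hφ⟩ := hC z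
  have eventuallyEq_of_source {f g : E → E} (h : ∀ w ∈ e.source, f (e w) = g (e w)) :
      f =ᶠ[𝓝 (e z)] g := by
    filter_upwards [e.open_target.mem_nhds (e.map_source hz)] with q hq
    simpa only [e.right_inv hq] using h (e.symm q) (e.map_target hq)
  let A : E →L[ℝ] E := φ.symm.toContinuousLinearMap ∘L
    (.inr ℝ (Fin n → ℝ) (Fin n → ℝ) ∘L .snd ℝ (Fin n → ℝ) (Fin n → ℝ)) ∘L
      φ.toContinuousLinearMap
  let B : E →L[ℝ] E := φ.symm.toContinuousLinearMap ∘L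
    (.inr ℝ (Fin n → ℝ) (Fin n → ℝ) ∘L .fst ℝ (Fin n → ℝ) (Fin n → ℝ)) ∘L
      φ.toContinuousLinearMap
  refine ⟨e, he, hz, A, B, ?_, ?_,
    eventuallyEq_of_source fun w hw => ?_, fun X => eventuallyEq_of_source fun w hw => ?_⟩
  · ext v
    simp [A, B]
  · ext v
    simp [A, B]
  · rw [coordRep_apply he C hw]
    exact φ.eq_symm_apply.2 (hφ w hw).2
  · rw [coordRep_apply he (L X) hw, coordRep_apply he X hw]
    exact φ.eq_symm_apply.2 ((hφ w hw).1 X)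

theorem IsCanonicalField.fn01_eq_neg [FiniteDimensional ℝ E] {n : ℕ} {L : VForm1 E M}
    {C : VField E M} (hC : IsCanonicalField n L C) : fn01 C L = -L := by
  have : CompleteSpace E := FiniteDimensional.complete ℝ E
  ext Y z
  obtain ⟨e, he, hz, A, B, hAB, hBA, hCA, hLB⟩ := hC.exists_coordRep_eventuallyEq z
  have hp : e z ∈ e.target := e.map_source hz
  have coordRep_L (X : VField E M) : coordRep e (L X) (e z) = B (coordRep e X (e z)) :=
    (hLB X).self_of_nhds
  refine coordRep_injective_at he hz ?_
  calc coordRep e (fn01 C L Y) (e z)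
      = coordRep e ⁅C, L Y⁆ (e z) - coordRep e (L ⁅C, Y⁆) (e z) := by
        rw [fn01_apply, map_sub, Pi.sub_apply]
    _ = lieBracket ℝ A (fun q => B (coordRep e Y q)) (e z)
          - B (lieBracket ℝ A (coordRep e Y) (e z)) := by
        rw [coordRep_L, coordRep_lie he _ _ hp, coordRep_lie he _ _ hp,
          hCA.lieBracket_vectorField_eq (hLB Y), hCA.lieBracket_vectorField_eq .rfl]
    _ = -B (coordRep e Y (e z)) :=
        lieBracket_clm_comp hAB hBA (differentiableAt_coordRep he Y hp)
    _ = coordRep e ((-L) Y) (e z) := by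
        rw [LinearMap.neg_apply, map_neg, Pi.neg_apply, coordRep_L]

end Coordinates

end LConn

theorem theorem5_general {E M : Type*} [NormedAddCommGroup E] [NormedSpace ℝ E]
    [FiniteDimensional ℝ E] [TopologicalSpace M] [T2Space M] [ChartedSpace E M]
    [IsManifold 𝓘(ℝ, E) ∞ M] (L Γ : VForm1 E M) :
    fn12 L (curvature Γ) = fn12 (horProj Γ) (torsion L Γ) ∧
    fn12 (horProj Γ) (curvature Γ) = 0 ∧
    (IsAlmostTangent L → fn11 L L = 0 → IsLConnection L Γ →
      ∀ C : VField E M, fn01 C L = -L →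
        ∀ S S' : VField E M, IsCanonicalSemispray L C Γ S → IsSemispray L C S' →
          fn12 (fn10 L S) (curvature Γ) = -fn12 (strongTorsion L C Γ S') (curvature Γ)) :=
  ⟨fn12_curvature L Γ, fn12_horProj_curvature Γ, fun hL hLL hΓ _ hC _ _ hS hS' =>
    fn12_fn10_curvature hL hLL hΓ hC hS hS'⟩

theorem theorem5 {E M : Type*} [NormedAddCommGroup E] [NormedSpace ℝ E] [FiniteDimensional ℝ E]
    [TopologicalSpace M] [T2Space M] [ParacompactSpace M] [ChartedSpace E M]
    [IsManifold 𝓘(ℝ, E) ∞ M]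
    (n : ℕ) (L : VForm1 E M) (hL : IsLStructure n L)
    (Γ : VForm1 E M) (hΓ : IsLConnection L Γ) :
    fn12 L (curvature Γ) = fn12 (horProj Γ) (torsion L Γ) ∧
    fn12 (horProj Γ) (curvature Γ) = 0 ∧
    ∀ C : VField E M, IsCanonicalField n L C →
      ∀ S S' : VField E M, IsCanonicalSemispray L C Γ S → IsSemispray L C S' →
        fn12 (fn10 L S) (curvature Γ) = -fn12 (strongTorsion L C Γ S') (curvature Γ) := by
  obtain ⟨bianchi_L, bianchi_h, bianchi_S⟩ := theorem5_general L Γ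
  exact ⟨bianchi_L, bianchi_h, fun C hC =>
    bianchi_S hL.isAlmostTangent hL.fn11_self hΓ C hC.fn01_eq_neg⟩
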